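/- **Setting.** Let $\mathbb{C}$ be a complete, cocomplete and well-powered category in which strong epimorphisms are stable under pullback and which is locally distributive (every slice $\mathbb{C}/X$ is distributive, i.e. has finite products and finite coproducts, and each functor $A\times(-)$ on it preserves finite coproducts). *Relations.* A graph $(X,R)$ is a parallel pair $\mathsf{outl}_R,\mathsf{outr}_R\colon R\rightrightarrows X$; it is a relation if the pair is jointly monic. Graph morphisms are pairs $(h_0,h_1)$ commuting with $\mathsf{outl}$ and $\mathsf{outr}$; relations and graph morphisms form the category $\mathbf{Rel}(\mathbb{C})$ with forgetful functor $(X,R)\mapsto X$ to $\mathbb{C}$. Write $(X,R)\le (X,S)$ if there is a graph morphism with $h_0=\mathrm{id}_X$; $(X,R)^\dagger$ for the relation obtained from the (strong epi, mono)-factorization of $\langle\mathsf{outl}_R,\mathsf{outr}_R\rangle$; $(X,X)$ for the identity relation; and $(X,R)\bullet(X,S)$ for the relation $(-)^\dagger$ of the composite graph $R\times_X S$ (the pullback of $\mathsf{outr}_R$ and $\mathsf{outl}_S$). For $f\colon X\to Y$, $f_\star(X,R)$ is the graph $(Y,R,f\circ\mathsf{outl}_R,f\circ\mathsf{outr}_R)$.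 Products $(X,R)\times(Y,S)$ are formed componentwise and $(X,R)\vee(Y,S)=(X+Y,R+S)^\dagger$. The canonical relation lifting of an endofunctor $F$ is $\overline F(X,R)=(FX,FR,F\mathsf{outl}_R,F\mathsf{outr}_R)^\dagger$. *Data.* Let $V\in\mathbb{C}$, let $\Sigma=V+\Sigma'$ be an endofunctor of $\mathbb{C}$ that preserves strong epimorphisms and has free algebras on all objects (with free monad $\Sigma^\star$), and let $\iota\colon\Sigma(\mu\Sigma)\to\mu\Sigma$ be an initial $\Sigma$-algebra. Every $\Sigma$-algebra $(A,a)$ is $V$-pointed by $V\xrightarrow{\mathsf{inl}}\Sigma A\xrightarrow{a}A$. Let $B\colon\mathbb{C}^{\mathrm{op}}\times\mathbb{C}\to\mathbb{C}$ be a functor with a relation lifting $\overline B$, i.e. a functor $\mathbf{Rel}(\mathbb{C})^{\mathrm{op}}\times\mathbf{Rel}(\mathbb{C})\to\mathbf{Rel}(\mathbb{C})$ strictly over $B$, which is *good for simulations* with respect to the equality preorder on $B$. This means that for all relations $(X,R),(Y,S),(Y,S')$: 1. every right-lax graph morphism over the identity of $B(X,Y)$ (with $\mathsf{outr}$ preserved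 only up to the chosen preorder) from a graph into $\overline B((X,R),(Y,S))$ can be replaced by a strict one (automatic for the equality preorder); 2. the relation $\overline B((X,X),(Y,Y))$ is reflexive, i.e. contains the identity relation; 3. $\overline B((X,R),(Y,S))\bullet\overline B((X,X),(Y,S'))\le\overline B((X,R),(Y,S)\bullet(Y,S'))$. Let $\rho_{X,Y}\colon\Sigma(X\times B(X,Y))\to B(X,\Sigma^\star(X+Y))$ be a $V$-pointed higher-order GSOS law (dinatural in $X\in V/\mathbb{C}$, natural in $Y\in\mathbb{C}$) that admits a relation lifting: for all $(X,R)$ with a $\mathbf{Rel}(\mathbb{C})$-morphism $(V,V)\to(X,R)$ and all $(Y,S)$, the morphism $\rho_{X,Y}$ (for the induced point $V\to X$) is the first component of a $\mathbf{Rel}(\mathbb{C})$-morphism $$\overline\Sigma\big((X,R)\times\overline B((X,R),(Y,S))\big)\to\overline B\big((X,R),\overline{\Sigma}^{\star}((X,R)\vee(Y,S))\big),$$ where $\overline\Sigma^{\star}=\overline{\Sigma^\star}$ is the free monad on $\overline\Sigma$. *Operational model.* Let $\gamma\colon\mu\Sigma\to B(\mu\Sigma,\mu\Sigma)$ be the operational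 model of $\rho$, i.e. the unique morphism with $$\gamma\circ\iota=B(\mathrm{id},\hat\iota)\circ B(\mathrm{id},\Sigma^\star\nabla)\circ\rho_{\mu\Sigma,\mu\Sigma}\circ\Sigma\langle\mathrm{id},\gamma\rangle,$$ where $\nabla\colon\mu\Sigma+\mu\Sigma\to\mu\Sigma$ is the codiagonal and $\hat\iota\colon\Sigma^\star(\mu\Sigma)\to\mu\Sigma$ is the Eilenberg–Moore algebra induced by $\iota$. A relation $(\mu\Sigma,R)$ is a *simulation* if $\gamma_\star(\mu\Sigma,R)\le\overline B((\mu\Sigma,\mu\Sigma),(\mu\Sigma,R))$; *similarity* is the greatest simulation. (This is weak similarity for the trivial weakening $\widetilde\gamma=\gamma$.) **Corollary.** The similarity relation on $(\mu\Sigma,\gamma)$ exists, and it is a congruence: if $(\mu\Sigma,R)$ is the similarity relation, then $\iota_\star\overline\Sigma(\mu\Sigma,R)\le(\mu\Sigma,R)$. -/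

import Mathlib

open CategoryTheory CategoryTheory.Limits Opposite

universe v u

-- Morphisms of a category are to be read through its own category structure.
attribute [-instance] CategoryTheory.catToReflQuiver

namespace HOGSOS

/-! ### Conditions on the base category -/

/-- A category is distributive if it has finite products and finite coproducts and every
functor `X × (-)` preserves finite coproducts. -/
class Distributive (D : Type u) [Category.{v} D] : Prop where
  hasFiniteProducts : HasFiniteProducts D
  hasFiniteCoproducts : HasFiniteCoproducts D
  preserves : ∀ X : D, PreservesFiniteCoproducts (prod.functor.obj X)

/-- A category is locally distributive if all its slice categories are distributive. -/
def LocallyDistributive (C : Type u) [Category.{v} C] : Prop :=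
  ∀ X : C, Distributive (Over X)

/-- Strong epimorphisms are stable under pullback along arbitrary morphisms. -/
def StrongEpiPullbackStable (C : Type u) [Category.{v} C] : Prop :=
  ∀ ⦃P X Y Z : C⦄ (f' : P ⟶ X) (e' : P ⟶ Y) (e : X ⟶ Z) (f : Y ⟶ Z),
    IsPullback f' e' e f → StrongEpi e → StrongEpi e'

/-- The functor preserves strong epimorphisms. -/
def PreservesStrongEpi {C : Type u} [Category.{v} C] (F : C ⥤ C) : Prop :=
  ∀ ⦃X Y : C⦄ (e : X ⟶ Y), StrongEpi e → StrongEpi (F.map e)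

theorem strongEpi_of_extremal {C : Type u} [Category.{v} C] [HasPullbacks C] [HasEqualizers C]
    {X I : C} (e : X ⟶ I)
    (he : ∀ {A : C} (g : X ⟶ A) (n : A ⟶ I), Mono n → g ≫ n = e → IsIso n) : StrongEpi e := by
  refine StrongEpi.mk ⟨fun {Z} a b hab => ?_⟩ fun A B z hz => ⟨fun {t w} sq => ?_⟩
  · have := he (equalizer.lift e hab) (equalizer.ι a b) inferInstance (equalizer.lift_ι _ _)
    exact eq_of_epi_equalizer
  · have := he (pullback.lift t e sq.w) (pullback.snd z w) inferInstance (pullback.lift_snd _ _ _)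
    refine ⟨⟨⟨inv (pullback.snd z w) ≫ pullback.fst z w, ?_, ?_⟩⟩⟩
    · rw [← cancel_mono z]
      simp [pullback.condition, sq.w]
    · simp [pullback.condition]

/-- In a complete well-powered category every morphism has a (strong epi, mono)-factorization,
through the least subobject of the codomain that it factors through. -/
instance hasStrongEpiMonoFactorisations (C : Type u) [Category.{v} C] [HasLimits C]
    [WellPowered.{v} C] : HasStrongEpiMonoFactorisations C := by
  refine HasStrongEpiMonoFactorisations.mk fun {X Y} f => ?_
  let T := {P : Subobject Y // P.Factors f}
  let σ : Shrink.{v} T ≃ T := (equivShrink.{v} T).symm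
  let obj : Shrink.{v} T → C := fun j => ((σ j).1 : C)
  let arr : ∀ j, obj j ⟶ Y := fun j => (σ j).1.arrow
  let I : C := widePullback Y obj arr
  let m : I ⟶ Y := WidePullback.base arr
  have hm : Mono m := ⟨fun a b hab => WidePullback.hom_ext arr _ _ (fun j => by
    rw [← cancel_mono (arr j)]
    simpa using hab) hab⟩
  let e : X ⟶ I := WidePullback.lift f (fun j => (σ j).1.factorThru f (σ j).2) (fun j => by
    simp [arr])
  have hem : e ≫ m = f := WidePullback.lift_base _ _ _ _
  refine { I := I, m := m, e := e, fac := hem, e_strong_epi := ?_ }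
  refine strongEpi_of_extremal e fun {A} g n hn hgn => ?_
  have hfac : (Subobject.mk (n ≫ m)).Factors f := (Subobject.mk_factors_iff _ _).2
    ⟨g, by simp [← hem, ← hgn]⟩
  let j : Shrink.{v} T := σ.symm ⟨_, hfac⟩
  have hle : Subobject.mk m ≤ Subobject.mk (n ≫ m) := by
    have hj : (σ j).1 = Subobject.mk (n ≫ m) := by simp [j]
    rw [← hj]
    exact Subobject.mk_le_of_comm (WidePullback.π arr j) (WidePullback.π_arrow arr j)
  have hs : Subobject.ofMkLEMk _ _ hle ≫ n = 𝟙 I := by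
    rw [← cancel_mono m, Category.assoc, Subobject.ofMkLEMk_comp, Category.id_comp]
  have : IsSplitEpi n := ⟨⟨⟨_, hs⟩⟩⟩
  exact isIso_of_mono_of_isSplitEpi n

/-! ### Graphs and relations -/

section Graphs

variable {C : Type u} [Category.{v} C]

/-- A graph `(X, R)` on the fixed object `X`: a parallel pair `R ⇉ X`. -/
structure GraphOn (X : C) where
  carrier : C
  outl : carrier ⟶ X
  outr : carrier ⟶ X

/-- `R.Maps f S`: there is a graph morphism from `(X, R)` to `(Y, S)` with vertex part `f`. -/
def GraphOn.Maps {X Y : C} (R : GraphOn X) (f : X ⟶ Y) (S : GraphOn Y) : Prop :=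
  ∃ h : R.carrier ⟶ S.carrier, h ≫ S.outl = R.outl ≫ f ∧ h ≫ S.outr = R.outr ≫ f

/-- `R ≤ S` for graphs on `X`: there is a graph morphism `R ⟶ S` that is the identity on `X`. -/
instance (X : C) : LE (GraphOn X) where
  le R S := ∃ h : R.carrier ⟶ S.carrier, h ≫ S.outl = R.outl ∧ h ≫ S.outr = R.outr

/-- The reindexing `f_⋆ (X, R)` of a graph along `f : X ⟶ Y`. -/
@[simps]
abbrev GraphOn.push {X Y : C} (f : X ⟶ Y) (R : GraphOn X) : GraphOn Y where
  carrier := R.carrier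
  outl := R.outl ≫ f
  outr := R.outr ≫ f

/-- A relation on `X`: a graph on `X` whose two legs are jointly monic. -/
structure RelOn (X : C) extends GraphOn X where
  jointlyMono : ∀ {W : C} (a b : W ⟶ carrier),
    a ≫ outl = b ≫ outl → a ≫ outr = b ≫ outr → a = b

/-- The order on relations inherited from graphs. -/
instance (X : C) : LE (RelOn X) where
  le R S := R.toGraphOn ≤ S.toGraphOn

/-- The identity relation `(X, X)`. -/
@[simps toGraphOn_carrier toGraphOn_outl toGraphOn_outr]
abbrev RelOn.id (X : C) : RelOn X where
  carrier := X
  outl := 𝟙 X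
  outr := 𝟙 X
  jointlyMono a b h _ := by simpa using h

/-- Reindexing along a monomorphism preserves relations. -/
abbrev RelOn.push {X Y : C} (f : X ⟶ Y) [Mono f] (R : RelOn X) : RelOn Y where
  toGraphOn := R.toGraphOn.push f
  jointlyMono a b h h' := by
    refine R.jointlyMono a b ?_ ?_
    · rw [← cancel_mono f, Category.assoc, Category.assoc]
      exact h
    · rw [← cancel_mono f, Category.assoc, Category.assoc]
      exact h'

/-- A relation is reflexive if it contains the identity relation. -/
def RelOn.IsReflexive {X : C} (R : RelOn X) : Prop := RelOn.id X ≤ R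

/-- The canonical graph lifting of an endofunctor, `(X, R) ↦ (F X, F R)`. -/
@[simps]
abbrev GraphOn.lift (F : C ⥤ C) {X : C} (R : GraphOn X) : GraphOn (F.obj X) where
  carrier := F.obj R.carrier
  outl := F.map R.outl
  outr := F.map R.outr

/-- The coproduct `(X, R) + (Y, S)` of graphs. -/
@[simps]
noncomputable abbrev GraphOn.coprod [HasBinaryCoproducts C] {X Y : C} (R : GraphOn X) (S : GraphOn Y) :
    GraphOn (X ⨿ Y) where
  carrier := R.carrier ⨿ S.carrier
  outl := coprod.map R.outl S.outl
  outr := coprod.map R.outr S.outr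

/-- The composite `(X, R) ; (X, S)` of graphs. -/
@[simps]
noncomputable abbrev GraphOn.comp [HasPullbacks C] {X : C} (R S : GraphOn X) : GraphOn X where
  carrier := pullback R.outr S.outl
  outl := pullback.fst R.outr S.outl ≫ R.outl
  outr := pullback.snd R.outr S.outl ≫ S.outr

/-- The product `(X, R) × (Y, S)` of relations. -/
@[simps toGraphOn_carrier toGraphOn_outl toGraphOn_outr]
noncomputable abbrev RelOn.prod [HasBinaryProducts C] {X Y : C} (R : RelOn X) (S : RelOn Y) :
    RelOn (X ⨯ Y) where
  carrier := R.carrier ⨯ S.carrier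
  outl := prod.map R.outl S.outl
  outr := prod.map R.outr S.outr
  jointlyMono a b h h' := by
    apply Limits.prod.hom_ext
    · apply R.jointlyMono
      · simpa using congrArg (· ≫ prod.fst) h
      · simpa using congrArg (· ≫ prod.fst) h'
    · apply S.jointlyMono
      · simpa using congrArg (· ≫ prod.snd) h
      · simpa using congrArg (· ≫ prod.snd) h'

end Graphs

/-- Diagonal fill-in of a strong epimorphism against a relation. -/
theorem exists_diagonal {C : Type u} [Category.{v} C] [HasBinaryProducts C] {A D Y : C} (e : A ⟶ D)
    [StrongEpi e] (S : RelOn Y)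
    (h : A ⟶ S.carrier) (l r : D ⟶ Y) (hl : h ≫ S.outl = e ≫ l) (hr : h ≫ S.outr = e ≫ r) :
    ∃ k : D ⟶ S.carrier, k ≫ S.outl = l ∧ k ≫ S.outr = r := by
  let m : S.carrier ⟶ Y ⨯ Y := prod.lift S.outl S.outr
  have hm : Mono m := ⟨fun a b hab => S.jointlyMono a b
    (by simpa [m, prod.lift_fst] using congrArg (· ≫ prod.fst) hab)
    (by simpa [m, prod.lift_snd] using congrArg (· ≫ prod.snd) hab)⟩
  have sq : CommSq h e m (prod.lift l r) :=
    ⟨Limits.prod.hom_ext (by simp [m, prod.lift_fst, hl]) (by simp [m, prod.lift_snd, hr])⟩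
  have hlift : sq.HasLift := (StrongEpi.llp (f := e) m).sq_hasLift sq
  exact ⟨sq.lift, by simpa [m, prod.lift_fst] using congrArg (· ≫ prod.fst) sq.fac_right,
    by simpa [m, prod.lift_snd] using congrArg (· ≫ prod.snd) sq.fac_right⟩

section Dagger

variable {C : Type u} [Category.{v} C] [HasLimits C] [WellPowered.{v} C]

/-- The relation `(X, R)^†` generated by a graph: the image, in the (strong epi, mono)-factorization,
of the pairing of its two legs. -/
noncomputable def GraphOn.dagger {X : C} (R : GraphOn X) : RelOn X where
  carrier := image (prod.lift R.outl R.outr)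
  outl := image.ι (prod.lift R.outl R.outr) ≫ prod.fst
  outr := image.ι (prod.lift R.outl R.outr) ≫ prod.snd
  jointlyMono a b h h' := by
    rw [← cancel_mono (image.ι (prod.lift R.outl R.outr))]
    apply Limits.prod.hom_ext
    · simpa using h
    · simpa using h'

/-- The strong epimorphism `e_R : R ⟶ R^†`. -/
noncomputable def GraphOn.toDagger {X : C} (R : GraphOn X) : R.carrier ⟶ R.dagger.carrier :=
  factorThruImage (prod.lift R.outl R.outr)

instance {X : C} (R : GraphOn X) : StrongEpi R.toDagger :=
  inferInstanceAs (StrongEpi (factorThruImage (prod.lift R.outl R.outr)))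

@[simp]
theorem GraphOn.toDagger_outl {X : C} (R : GraphOn X) : R.toDagger ≫ R.dagger.outl = R.outl := by
  simp [GraphOn.toDagger, GraphOn.dagger, prod.lift_fst]

@[simp]
theorem GraphOn.toDagger_outr {X : C} (R : GraphOn X) : R.toDagger ≫ R.dagger.outr = R.outr := by
  simp [GraphOn.toDagger, GraphOn.dagger, prod.lift_snd]

/-- `(X, R)^†` is the reflection of the graph `(X, R)` into relations. -/
theorem GraphOn.dagger_maps_iff {X Y : C} (R : GraphOn X) (f : X ⟶ Y) (S : RelOn Y) :
    R.dagger.toGraphOn.Maps f S.toGraphOn ↔ R.Maps f S.toGraphOn := by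
  constructor
  · rintro ⟨h, hl, hr⟩
    exact ⟨R.toDagger ≫ h, by rw [Category.assoc, hl, ← Category.assoc, GraphOn.toDagger_outl],
      by rw [Category.assoc, hr, ← Category.assoc, GraphOn.toDagger_outr]⟩
  · rintro ⟨h, hl, hr⟩
    exact exists_diagonal R.toDagger S h (R.dagger.outl ≫ f) (R.dagger.outr ≫ f)
      (by rw [hl, ← Category.assoc, GraphOn.toDagger_outl])
      (by rw [hr, ← Category.assoc, GraphOn.toDagger_outr])

/-- The composite `(X, R) • (X, S)` of relations. -/
noncomputable def RelOn.comp {X : C} (R S : RelOn X) : RelOn X :=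
  (R.toGraphOn.comp S.toGraphOn).dagger

/-- The coproduct `(X, R) ∨ (Y, S)` of relations. -/
noncomputable def RelOn.coprod [HasBinaryCoproducts C] {X Y : C} (R : RelOn X) (S : RelOn Y) :
    RelOn (X ⨿ Y) :=
  (R.toGraphOn.coprod S.toGraphOn).dagger

/-- The canonical relation lifting of an endofunctor, `(X, R) ↦ (F X, F R)^†`. -/
noncomputable def RelOn.lift (F : C ⥤ C) {X : C} (R : RelOn X) : RelOn (F.obj X) :=
  (R.toGraphOn.lift F).dagger

/-- A relation on the carrier of an algebra `(A, a)` is a congruence if `a_⋆ F̄(A, R) ≤ (A, R)`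
for the canonical relation lifting `F̄`. -/
def IsCongruence {F : C ⥤ C} (A : Endofunctor.Algebra F) (R : RelOn A.a) : Prop :=
  (R.lift F).toGraphOn.push A.str ≤ R.toGraphOn

end Dagger

/-! ### The category of relations, and relation liftings of functors -/

/-- An object of the category `Rel(C)`: an object of `C` with a relation on it. -/
structure RelCat (C : Type u) [Category.{v} C] where
  base : C
  rel : RelOn base

/-- A morphism of `Rel(C)`: a graph morphism `(h₀, h₁)`. -/
@[ext]
structure RelCat.Hom {C : Type u} [Category.{v} C] (R S : RelCat C) where
  h₀ : R.base ⟶ S.base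
  h₁ : R.rel.carrier ⟶ S.rel.carrier
  outl : h₁ ≫ S.rel.outl = R.rel.outl ≫ h₀
  outr : h₁ ≫ S.rel.outr = R.rel.outr ≫ h₀

section Liftings

variable {C : Type u} [Category.{v} C]

@[simps]
instance : Category (RelCat C) where
  Hom := RelCat.Hom
  id R := ⟨𝟙 _, 𝟙 _, by simp, by simp⟩
  comp f g := ⟨f.h₀ ≫ g.h₀, f.h₁ ≫ g.h₁,
    by rw [Category.assoc, g.outl, ← Category.assoc, f.outl, Category.assoc],
    by rw [Category.assoc, g.outr, ← Category.assoc, f.outr, Category.assoc]⟩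
  id_comp f := RelCat.Hom.ext (Category.id_comp f.h₀) (Category.id_comp f.h₁)
  comp_id f := RelCat.Hom.ext (Category.comp_id f.h₀) (Category.comp_id f.h₁)
  assoc f g h := RelCat.Hom.ext (Category.assoc f.h₀ g.h₀ h.h₀) (Category.assoc f.h₁ g.h₁ h.h₁)

/-- A morphism of `Rel(C)` is determined by its vertex part. -/
theorem RelCat.hom_ext {R S : RelCat C} (f g : R ⟶ S) (h : f.h₀ = g.h₀) : f = g :=
  RelCat.Hom.ext h (S.rel.jointlyMono _ _ (by rw [f.outl, g.outl, h]) (by rw [f.outr, g.outr, h]))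

/-- The projection functor `Rel(C) ⥤ C`, `(X, R) ↦ X`. -/
@[simps]
def RelCat.forget (C : Type u) [Category.{v} C] : RelCat C ⥤ C where
  obj R := R.base
  map f := f.h₀

/-- A relation lifting of an endofunctor `F`: a functor `Rel(C) ⥤ Rel(C)` that lies strictly
over `F`. -/
structure EndoLifting (F : C ⥤ C) where
  functor : RelCat C ⥤ RelCat C
  comm : functor ⋙ RelCat.forget C = RelCat.forget C ⋙ F

theorem EndoLifting.base_eq {F : C ⥤ C} (L : EndoLifting F) (R : RelCat C) :
    (L.functor.obj R).base = F.obj R.base :=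
  Functor.congr_obj L.comm R

/-- The relation `F̄(X, R)`, as a relation on `F X`. (The reindexing is along the identification
`|F̄(X, R)| = F X`.) -/
def EndoLifting.rel {F : C ⥤ C} (L : EndoLifting F) {X : C} (R : RelOn X) : RelOn (F.obj X) :=
  (L.functor.obj ⟨X, R⟩).rel.push (eqToHom (L.base_eq ⟨X, R⟩))

/-- A relation lifting of a mixed-variance bifunctor `B`: a functor
`Rel(C)ᵒᵖ × Rel(C) ⥤ Rel(C)` that lies strictly over `B`. -/
structure BifunctorLifting (B : Cᵒᵖ × C ⥤ C) where
  functor : (RelCat C)ᵒᵖ × RelCat C ⥤ RelCat C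
  comm : functor ⋙ RelCat.forget C = (RelCat.forget C).op.prod (RelCat.forget C) ⋙ B

theorem BifunctorLifting.base_eq {B : Cᵒᵖ × C ⥤ C} (L : BifunctorLifting B) (R S : RelCat C) :
    (L.functor.obj (op R, S)).base = B.obj (op R.base, S.base) :=
  Functor.congr_obj L.comm (op R, S)

/-- The relation `B̄((X, R), (Y, S))`, as a relation on `B(X, Y)`. (The reindexing is along the
identification `|B̄((X, R), (Y, S))| = B(X, Y)`.) -/
def BifunctorLifting.rel {B : Cᵒᵖ × C ⥤ C} (L : BifunctorLifting B) {X Y : C}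
    (R : RelOn X) (S : RelOn Y) : RelOn (B.obj (op X, Y)) :=
  (L.functor.obj (op ⟨X, R⟩, ⟨Y, S⟩)).rel.push
    (eqToHom (L.base_eq ⟨X, R⟩ ⟨Y, S⟩))

theorem comp_eqToHom_of_eq {a b c d : C} (x : a ⟶ b) (y : c ⟶ d) (h₁ : a = c) (h₂ : b = d)
    (h₃ : d = b) (hx : x = eqToHom h₁ ≫ y ≫ eqToHom h₃) :
    x ≫ eqToHom h₂ = eqToHom h₁ ≫ y := by
  subst hx h₁ h₂
  simp

/-- A lifting of `B` takes morphisms of relations to morphisms of relations. -/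
theorem BifunctorLifting.maps_rel {B : Cᵒᵖ × C ⥤ C} (L : BifunctorLifting B) {X X' Y Y' : C}
    {R : RelOn X} {R' : RelOn X'} {S : RelOn Y} {S' : RelOn Y'} (f : X' ⟶ X) (g : Y ⟶ Y')
    (hf : R'.toGraphOn.Maps f R.toGraphOn) (hg : S.toGraphOn.Maps g S'.toGraphOn) :
    (L.rel R S).toGraphOn.Maps (B.map (Prod.mkHom f.op g)) (L.rel R' S').toGraphOn := by
  obtain ⟨f₁, hfl, hfr⟩ := hf
  obtain ⟨g₁, hgl, hgr⟩ := hg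
  let φ : (⟨X', R'⟩ : RelCat C) ⟶ ⟨X, R⟩ := ⟨f, f₁, hfl, hfr⟩
  let ψ : (⟨Y, S⟩ : RelCat C) ⟶ ⟨Y', S'⟩ := ⟨g, g₁, hgl, hgr⟩
  let k := L.functor.map (Prod.mkHom φ.op ψ)
  have hk : k.h₀ ≫ eqToHom (L.base_eq ⟨X', R'⟩ ⟨Y', S'⟩) =
      eqToHom (L.base_eq ⟨X, R⟩ ⟨Y, S⟩) ≫ B.map (Prod.mkHom f.op g) :=
    comp_eqToHom_of_eq _ _ _ _ _ (Functor.congr_hom L.comm (Prod.mkHom φ.op ψ))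
  refine ⟨k.h₁, ?_, ?_⟩
  · change k.h₁ ≫ _ ≫ eqToHom (L.base_eq ⟨X', R'⟩ ⟨Y', S'⟩) =
      (_ ≫ eqToHom (L.base_eq ⟨X, R⟩ ⟨Y, S⟩)) ≫ _
    rw [← Category.assoc, k.outl, Category.assoc, Category.assoc, hk]
  · change k.h₁ ≫ _ ≫ eqToHom (L.base_eq ⟨X', R'⟩ ⟨Y', S'⟩) =
      (_ ≫ eqToHom (L.base_eq ⟨X, R⟩ ⟨Y, S⟩)) ≫ _
    rw [← Category.assoc, k.outr, Category.assoc, Category.assoc, hk]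

/-- The lifting `B̄((X, R), -)` of the endofunctor `B(X, -)`. -/
def BifunctorLifting.fixLeft {B : Cᵒᵖ × C ⥤ C} (L : BifunctorLifting B) {X : C} (R : RelOn X) :
    EndoLifting (Prod.sectR (op X) C ⋙ B) where
  functor := Prod.sectR (op (⟨X, R⟩ : RelCat C)) (RelCat C) ⋙ L.functor
  comm := congrArg (fun G : (RelCat C)ᵒᵖ × RelCat C ⥤ C =>
    Prod.sectR (op (⟨X, R⟩ : RelCat C)) (RelCat C) ⋙ G) L.comm

/-- `B̄((X, R), -)` sends `(Y, S)` to the relation `B̄((X, R), (Y, S))`. -/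
theorem BifunctorLifting.fixLeft_rel {B : Cᵒᵖ × C ⥤ C} (L : BifunctorLifting B) {X Y : C}
    (R : RelOn X) (S : RelOn Y) : (L.fixLeft R).rel S = L.rel R S := rfl

/-! ### Simulations and similarity -/

/-- The relation `(X, R)` is a simulation on the coalgebra `(X, c)` with respect to the relation
lifting `F̄` if `c_⋆ (X, R) ≤ F̄(X, R)`. -/
def IsSimulation {F : C ⥤ C} (L : EndoLifting F) (A : Endofunctor.Coalgebra F)
    (R : RelOn A.V) : Prop :=
  R.toGraphOn.push A.str ≤ (L.rel R).toGraphOn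

/-- The relation is the similarity relation, i.e. the greatest simulation. -/
def IsSimilarity {F : C ⥤ C} (L : EndoLifting F) (A : Endofunctor.Coalgebra F)
    (R : RelOn A.V) : Prop :=
  IsSimulation L A R ∧ ∀ S : RelOn A.V, IsSimulation L A S → S ≤ R

end Liftings

/-! ### Preorders, and liftings that are good for simulations -/

section Preorders

variable {C : Type u} [Category.{v} C]

/-- A preorder on an object `X`: preorders on all hom-sets into `X`, stable under
precomposition. -/
structure PreorderOn (X : C) where
  rel : ∀ {Y : C}, (Y ⟶ X) → (Y ⟶ X) → Prop
  refl : ∀ {Y : C} (f : Y ⟶ X), rel f f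
  trans : ∀ {Y : C} (f g h : Y ⟶ X), rel f g → rel g h → rel f h
  precomp : ∀ {Y Z : C} (h : Z ⟶ Y) (f g : Y ⟶ X), rel f g → rel (h ≫ f) (h ≫ g)

/-- The discrete (equality) preorder. -/
def PreorderOn.discrete (X : C) : PreorderOn X where
  rel f g := f = g
  refl _ := rfl
  trans _ _ _ h k := h.trans k
  precomp _ _ _ h := by rw [h]

/-- `(X, R) ⪯ (X, S)`: there is a right-lax graph morphism from `(X, R)` to `(X, S)` that is the
identity on `X`. -/
def GraphOn.LaxLE {X : C} (P : PreorderOn X) (R S : GraphOn X) : Prop :=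
  ∃ h : R.carrier ⟶ S.carrier, h ≫ S.outl = R.outl ∧ P.rel (h ≫ S.outr) R.outr

/-- A relation on a preordered object is good for simulations if right-lax morphisms from any
graph into it can be turned into strict ones. -/
def RelOn.GoodForSimulations {X : C} (P : PreorderOn X) (S : RelOn X) : Prop :=
  ∀ R : GraphOn X, R.LaxLE P S.toGraphOn → R ≤ S.toGraphOn

/-- A relation lifting of the bifunctor `B`, preordered by `P`, is good for simulations. -/
structure BifunctorLifting.GoodForSimulations [HasLimits C] [WellPowered.{v} C]
    {B : Cᵒᵖ × C ⥤ C} (P : ∀ D : Cᵒᵖ × C, PreorderOn (B.obj D)) (L : BifunctorLifting B) :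
    Prop where
  good : ∀ {X Y : C} (R : RelOn X) (S : RelOn Y), (L.rel R S).GoodForSimulations (P (op X, Y))
  refl : ∀ X Y : C, (L.rel (RelOn.id X) (RelOn.id Y)).IsReflexive
  comp : ∀ {X Y : C} (R : RelOn X) (S S' : RelOn Y),
    (L.rel R S).comp (L.rel (RelOn.id X) S') ≤ L.rel R (S.comp S')

end Preorders

/-! ### Free monads -/

section FreeMonad

variable {C : Type u} [Category.{v} C] (F : C ⥤ C) [(Endofunctor.Algebra.forget F).IsRightAdjoint]

/-- The free-forgetful adjunction of an endofunctor that has free algebras on all objects. -/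
noncomputable def freeAdj :
    (Endofunctor.Algebra.forget F).leftAdjoint ⊣ Endofunctor.Algebra.forget F :=
  Adjunction.ofIsRightAdjoint _

/-- The free monad `F^⋆`. -/
noncomputable def freeMonad : Monad C := (freeAdj F).toMonad

/-- The underlying endofunctor of the free monad `F^⋆`. -/
noncomputable abbrev freeFunctor : C ⥤ C := (freeMonad F).toFunctor

/-- The structure `F (F^⋆ X) ⟶ F^⋆ X` of the free algebra on `X`. -/
noncomputable def freeStr (X : C) : F.obj ((freeFunctor F).obj X) ⟶ (freeFunctor F).obj X :=
  ((Endofunctor.Algebra.forget F).leftAdjoint.obj X).str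

/-- The Eilenberg-Moore algebra `â : F^⋆ A ⟶ A` of an `F`-algebra `(A, a)`: the free extension
of the identity on `A`. -/
noncomputable def emStr {F : C ⥤ C} [(Endofunctor.Algebra.forget F).IsRightAdjoint]
    (A : Endofunctor.Algebra F) : (freeFunctor F).obj A.a ⟶ A.a :=
  ((freeAdj F).counit.app A).f

/-- If `F` preserves strong epimorphisms then the canonical relation lifting of `F^⋆` is the free
monad on the canonical relation lifting of `F`: the relation `(R.lift F^⋆)` carries the free
algebra on `R`. -/
theorem lift_freeFunctor_isFree [HasLimits C] [WellPowered.{v} C] (hF : PreservesStrongEpi F)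
    {X : C} (R : RelOn X) :
    R.toGraphOn.Maps ((freeMonad F).η.app X) (R.lift (freeFunctor F)).toGraphOn ∧
    ((R.lift (freeFunctor F)).lift F).toGraphOn.Maps (freeStr F X)
      (R.lift (freeFunctor F)).toGraphOn ∧
    ∀ (A : Endofunctor.Algebra F) (S : RelOn A.a), (S.lift F).toGraphOn.Maps A.str S.toGraphOn →
      ∀ h : X ⟶ A.a, R.toGraphOn.Maps h S.toGraphOn →
        ∃! k : (freeFunctor F).obj X ⟶ A.a,
          F.map k ≫ A.str = freeStr F X ≫ k ∧ (freeMonad F).η.app X ≫ k = h ∧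
            (R.lift (freeFunctor F)).toGraphOn.Maps k S.toGraphOn := by
  let adj := freeAdj F
  have nat : ∀ {Y Z : C} (g : Y ⟶ Z),
      F.map ((freeFunctor F).map g) ≫ freeStr F Z = freeStr F Y ≫ (freeFunctor F).map g :=
    fun g => ((Endofunctor.Algebra.forget F).leftAdjoint.map g).h
  have ηnat : ∀ {Y Z : C} (g : Y ⟶ Z),
      (freeMonad F).η.app Y ≫ (freeFunctor F).map g = g ≫ (freeMonad F).η.app Z :=
    fun g => ((freeMonad F).η.naturality g).symm
  -- free extensions
  have ext : ∀ {Y : C} (A : Endofunctor.Algebra F) (h : Y ⟶ A.a),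
      ∃ k : (freeFunctor F).obj Y ⟶ A.a, F.map k ≫ A.str = freeStr F Y ≫ k ∧
        (freeMonad F).η.app Y ≫ k = h := fun {Y} A h =>
    ⟨((adj.homEquiv Y A).symm h).f, ((adj.homEquiv Y A).symm h).h,
      (adj.homEquiv_unit _ _ _).symm.trans ((adj.homEquiv Y A).apply_symm_apply h)⟩
  have uniq : ∀ {Y : C} (A : Endofunctor.Algebra F) (k k' : (freeFunctor F).obj Y ⟶ A.a),
      F.map k ≫ A.str = freeStr F Y ≫ k → F.map k' ≫ A.str = freeStr F Y ≫ k' →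
        (freeMonad F).η.app Y ≫ k = (freeMonad F).η.app Y ≫ k' → k = k' := by
    intro Y A k k' hk hk' hη
    let κ : (Endofunctor.Algebra.forget F).leftAdjoint.obj Y ⟶ A := ⟨k, hk⟩
    let κ' : (Endofunctor.Algebra.forget F).leftAdjoint.obj Y ⟶ A := ⟨k', hk'⟩
    have : κ = κ' := (adj.homEquiv Y A).injective
      ((adj.homEquiv_unit Y A κ).trans (Eq.trans hη (adj.homEquiv_unit Y A κ').symm))
    exact congrArg Endofunctor.Algebra.Hom.f this
  set G : GraphOn ((freeFunctor F).obj X) := R.toGraphOn.lift (freeFunctor F) with hG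
  have hGD : R.lift (freeFunctor F) = G.dagger := rfl
  rw [hGD]
  refine ⟨⟨(freeMonad F).η.app R.carrier ≫ G.toDagger, ?_, ?_⟩, ?_, ?_⟩
  · exact (Category.assoc _ _ _).trans ((congrArg ((freeMonad F).η.app R.carrier ≫ ·)
      G.toDagger_outl).trans (ηnat R.outl))
  · exact (Category.assoc _ _ _).trans ((congrArg ((freeMonad F).η.app R.carrier ≫ ·)
      G.toDagger_outr).trans (ηnat R.outr))
  · refine (GraphOn.dagger_maps_iff _ _ _).2 ?_
    have hse : StrongEpi (F.map G.toDagger) := hF _ inferInstance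
    refine exists_diagonal (F.map G.toDagger) G.dagger (freeStr F R.carrier ≫ G.toDagger) _ _
      ?_ ?_
    · refine (Category.assoc _ _ _).trans ((congrArg (freeStr F R.carrier ≫ ·)
        G.toDagger_outl).trans ((nat R.outl).symm.trans ?_))
      change F.map G.outl ≫ _ = F.map G.toDagger ≫ F.map G.dagger.outl ≫ _
      rw [← Category.assoc, ← F.map_comp, G.toDagger_outl]
    · refine (Category.assoc _ _ _).trans ((congrArg (freeStr F R.carrier ≫ ·)
        G.toDagger_outr).trans ((nat R.outr).symm.trans ?_))
      change F.map G.outr ≫ _ = F.map G.toDagger ≫ F.map G.dagger.outr ≫ _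
      rw [← Category.assoc, ← F.map_comp, G.toDagger_outr]
  · intro A S hS h hh
    obtain ⟨k, hk, hkη⟩ := ext A h
    obtain ⟨s, hsl, hsr⟩ := (GraphOn.dagger_maps_iff _ _ _).1 hS
    obtain ⟨h₁, hl, hr⟩ := hh
    obtain ⟨k₁, hk₁, hkη₁⟩ := ext (⟨S.carrier, s⟩ : Endofunctor.Algebra F) h₁
    refine ⟨k, ⟨hk, hkη, (GraphOn.dagger_maps_iff _ _ _).2 ⟨k₁, ?_, ?_⟩⟩, ?_⟩
    · refine uniq A (k₁ ≫ S.outl) ((freeFunctor F).map R.outl ≫ k) ?_ ?_ ?_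
      · refine (congrArg (· ≫ A.str) (F.map_comp _ _)).trans ((Category.assoc _ _ _).trans
          ((congrArg (F.map k₁ ≫ ·) hsl.symm).trans ((Category.assoc _ _ _).symm.trans
          ((congrArg (· ≫ S.outl) hk₁).trans (Category.assoc _ _ _)))))
      · rw [F.map_comp, Category.assoc, hk, ← Category.assoc, nat, Category.assoc]
      · refine (Category.assoc _ _ _).symm.trans ((congrArg (· ≫ S.outl) hkη₁).trans ?_)
        rw [← Category.assoc, ηnat, Category.assoc, hkη]
        exact hl
    · refine uniq A (k₁ ≫ S.outr) ((freeFunctor F).map R.outr ≫ k) ?_ ?_ ?_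
      · refine (congrArg (· ≫ A.str) (F.map_comp _ _)).trans ((Category.assoc _ _ _).trans
          ((congrArg (F.map k₁ ≫ ·) hsr.symm).trans ((Category.assoc _ _ _).symm.trans
          ((congrArg (· ≫ S.outr) hk₁).trans (Category.assoc _ _ _)))))
      · rw [F.map_comp, Category.assoc, hk, ← Category.assoc, nat, Category.assoc]
      · refine (Category.assoc _ _ _).symm.trans ((congrArg (· ≫ S.outr) hkη₁).trans ?_)
        rw [← Category.assoc, ηnat, Category.assoc, hkη]
        exact hr
    · rintro k' ⟨hk', hkη', -⟩
      exact uniq A _ _ hk' hk (hkη'.trans hkη.symm)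

end FreeMonad

/-! ### Primitive recursion -/

section PrimRec

variable {C : Type u} [Category.{v} C] [HasBinaryProducts C]

/-- Primitive recursion out of an initial algebra. -/
noncomputable def primRec {F : C ⥤ C} {I : Endofunctor.Algebra F} (hI : IsInitial I) {A : C}
    (a : F.obj (I.a ⨯ A) ⟶ A) : I.a ⟶ A :=
  (hI.to (⟨I.a ⨯ A, prod.lift (F.map prod.fst ≫ I.str) a⟩ : Endofunctor.Algebra F)).f ≫ prod.snd

/-- `primRec hI a` is the unique solution of the primitive recursion equation. -/
theorem eq_primRec_iff {F : C ⥤ C} {I : Endofunctor.Algebra F} (hI : IsInitial I) {A : C}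
    (a : F.obj (I.a ⨯ A) ⟶ A) (f : I.a ⟶ A) :
    f = primRec hI a ↔ I.str ≫ f = F.map (prod.lift (𝟙 I.a) f) ≫ a := by
  let A' : Endofunctor.Algebra F := ⟨I.a ⨯ A, prod.lift (F.map prod.fst ≫ I.str) a⟩
  let p : A' ⟶ I := ⟨prod.fst, (prod.lift_fst _ _).symm⟩
  have hp : (hI.to A').f ≫ prod.fst = 𝟙 I.a :=
    congrArg Endofunctor.Algebra.Hom.f (hI.hom_ext (hI.to A' ≫ p) (𝟙 I))
  have hl : (hI.to A').f = prod.lift (𝟙 I.a) (primRec hI a) :=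
    Limits.prod.hom_ext (by rw [hp, prod.lift_fst]) (by rw [prod.lift_snd]; rfl)
  have hr : (hI.to A').f ≫ prod.snd = primRec hI a := rfl
  constructor
  · rintro rfl
    rw [← hl, ← hr, ← Category.assoc, ← (hI.to A').h, Category.assoc]
    exact congrArg (_ ≫ ·) (prod.lift_snd _ _)
  · intro h
    let q : I ⟶ A' := ⟨prod.lift (𝟙 I.a) f, Limits.prod.hom_ext
      (by
        change (_ ≫ prod.lift _ _) ≫ _ = (_ ≫ prod.lift _ _) ≫ _
        rw [Category.assoc, Category.assoc, prod.lift_fst, prod.lift_fst, ← Category.assoc,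
          ← F.map_comp, prod.lift_fst, F.map_id, Category.id_comp, Category.comp_id])
      (by
        change (_ ≫ prod.lift _ _) ≫ _ = (_ ≫ prod.lift _ _) ≫ _
        rw [Category.assoc, Category.assoc, prod.lift_snd, prod.lift_snd, h])⟩
    have hq : q = hI.to A' := hI.hom_ext _ _
    rw [← hr, ← hq]
    exact (prod.lift_snd _ _).symm

end PrimRec

/-! ### Higher-order GSOS laws -/

section Laws

variable {C : Type u} [Category.{v} C] [HasBinaryProducts C] [HasBinaryCoproducts C]

/-- The syntax functor `Σ = V + Σ'`. -/
@[simps]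
noncomputable def syntaxFunctor (V : C) (T : C ⥤ C) : C ⥤ C where
  obj X := V ⨿ T.obj X
  map f := coprod.map (𝟙 V) (T.map f)

/-- The carrier of an algebra for `Σ = V + Σ'`, as a `V`-pointed object. -/
noncomputable def pointed {V : C} {T : C ⥤ C} (A : Endofunctor.Algebra (syntaxFunctor V T)) :
    Under V :=
  Under.mk (Y := A.a) ((coprod.inl : V ⟶ V ⨿ T.obj A.a) ≫ A.str)

/-- A `V`-pointed higher-order GSOS law of `Σ = V + Σ'` over `B`: a family of morphisms
`Σ(X × B(X, Y)) ⟶ B(X, Σ^⋆(X + Y))`, dinatural in the `V`-pointed object `X` and natural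
in `Y`. -/
structure HOGSOSLaw (V : C) (T : C ⥤ C) (B : Cᵒᵖ × C ⥤ C)
    [(Endofunctor.Algebra.forget (syntaxFunctor V T)).IsRightAdjoint] where
  app : ∀ (X : Under V) (Y : C),
    (syntaxFunctor V T).obj (X.right ⨯ B.obj (op X.right, Y)) ⟶
      B.obj (op X.right, (freeFunctor (syntaxFunctor V T)).obj (X.right ⨿ Y))
  natural : ∀ (X : Under V) {Y Y' : C} (g : Y ⟶ Y'),
    (syntaxFunctor V T).map (prod.map (𝟙 X.right) (B.map (Prod.mkHom (𝟙 (op X.right)) g))) ≫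
        app X Y' =
      app X Y ≫ B.map (Prod.mkHom (𝟙 (op X.right))
        ((freeFunctor (syntaxFunctor V T)).map (coprod.map (𝟙 X.right) g)))
  dinatural : ∀ {X X' : Under V} (f : X ⟶ X') (Y : C),
    (syntaxFunctor V T).map (prod.map (𝟙 X.right) (B.map (Prod.mkHom f.right.op (𝟙 Y)))) ≫
        app X Y ≫ B.map (Prod.mkHom (𝟙 (op X.right))
          ((freeFunctor (syntaxFunctor V T)).map (coprod.map f.right (𝟙 Y)))) =
      (syntaxFunctor V T).map (prod.map f.right (𝟙 (B.obj (op X'.right, Y)))) ≫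
        app X' Y ≫ B.map (Prod.mkHom f.right.op
          (𝟙 ((freeFunctor (syntaxFunctor V T)).obj (X'.right ⨿ Y))))

variable {V : C} {T : C ⥤ C} {B : Cᵒᵖ × C ⥤ C}
  [(Endofunctor.Algebra.forget (syntaxFunctor V T)).IsRightAdjoint]

/-- The composite `Σ(A × B(A, A)) ⟶ B(A, Σ^⋆(A + A)) ⟶ B(A, Σ^⋆ A) ⟶ B(A, A)` that a
higher-order GSOS law induces for a `Σ`-algebra `(A, a)`. -/
noncomputable def HOGSOSLaw.algApp (ρ : HOGSOSLaw V T B)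
    (A : Endofunctor.Algebra (syntaxFunctor V T)) :
    (syntaxFunctor V T).obj (A.a ⨯ B.obj (op A.a, A.a)) ⟶ B.obj (op A.a, A.a) :=
  ρ.app (pointed A) A.a ≫
    B.map (Prod.mkHom (𝟙 (op A.a))
      ((freeFunctor (syntaxFunctor V T)).map (coprod.desc (𝟙 A.a) (𝟙 A.a)))) ≫
    B.map (Prod.mkHom (𝟙 (op A.a)) (emStr A))

/-- The operational model of a higher-order GSOS law: the `B(μΣ, -)`-coalgebra on the initial
algebra `μΣ` defined by primitive recursion. -/
noncomputable def HOGSOSLaw.operationalModel (ρ : HOGSOSLaw V T B)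
    {I : Endofunctor.Algebra (syntaxFunctor V T)} (hI : IsInitial I) :
    Endofunctor.Coalgebra (Prod.sectR (op I.a) C ⋙ B) where
  V := I.a
  str := primRec hI (ρ.algApp I)

/-- The operational model is the unique `γ` with `γ ∘ ι` equal to the composite of `Σ⟨id, γ⟩` and
the morphism `Σ(μΣ × B(μΣ, μΣ)) ⟶ B(μΣ, μΣ)` induced by the law. -/
theorem HOGSOSLaw.eq_operationalModel_iff (ρ : HOGSOSLaw V T B)
    {I : Endofunctor.Algebra (syntaxFunctor V T)} (hI : IsInitial I)
    (γ : I.a ⟶ B.obj (op I.a, I.a)) :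
    γ = (ρ.operationalModel hI).str ↔
      I.str ≫ γ = (syntaxFunctor V T).map (prod.lift (𝟙 I.a) γ) ≫ ρ.algApp I :=
  eq_primRec_iff hI (ρ.algApp I) γ

end Laws

/-- The law `ρ` admits a relation lifting along `B̄` (and the canonical relation lifting of `Σ`):
for all `(V, V)`-pointed relations `(X, R)` and all relations `(Y, S)`, the component `ρ_{X,Y}` is
the vertex part of a morphism of relations
`Σ̄((X, R) × B̄((X, R), (Y, S))) ⟶ B̄((X, R), Σ̄^⋆((X, R) ∨ (Y, S)))`.
Such morphisms are unique, and their (di)naturality is that of `ρ` (see `RelCat.hom_ext`); for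
`Σ̄^⋆` see `lift_freeFunctor_isFree`. -/
def HOGSOSLaw.HasRelLifting {C : Type u} [Category.{v} C] [HasLimits C] [HasColimits C]
    [WellPowered.{v} C] {V : C} {T : C ⥤ C} {B : Cᵒᵖ × C ⥤ C}
    [(Endofunctor.Algebra.forget (syntaxFunctor V T)).IsRightAdjoint]
    (ρ : HOGSOSLaw V T B) (L : BifunctorLifting B) : Prop :=
  ∀ (X : Under V) (R : RelOn X.right), (RelOn.id V).toGraphOn.Maps X.hom R.toGraphOn →
    ∀ (Y : C) (S : RelOn Y),
      ((R.prod (L.rel R S)).lift (syntaxFunctor V T)).toGraphOn.Maps (ρ.app X Y)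
        (L.rel R ((R.coprod S).lift (freeFunctor (syntaxFunctor V T)))).toGraphOn

end HOGSOS

namespace HOGSOS

/-! ### Calculus of graphs and relations: order, composition, functor liftings, restriction. -/

section GraphLemmas

variable {C : Type u} [Category.{v} C]

/-! The proof is Howe's method. Relations on `X` are subobjects of `X ⨯ X`, which form a complete
lattice, and a join of simulations is again a simulation; so similarity `S` exists
(`exists_greatest_maps`). Conditions 2 and 3 of goodness for simulations make the identity relation
and `S • S` simulations, so `S` is reflexive and transitive.

Congruence cannot be read off from `S` directly: the law compares related programs when the
contravariant argument of `B̄` carries the same relation as the covariant one, whereas a simulation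
has the identity there. So `S` is replaced by its Howe closure `H`, the least `R` with `ι_⋆ Σ(R) ; S
≤ R` (`exists_howe`). Reflexivity of `S` makes `H` a congruence, initiality makes `H` reflexive,
hence `S ≤ H`, and transitivity of `S` gives `H ; S ≤ H` (`howe_comp_le`, where stability of strong
epimorphisms enters).

The core is `howe_maps`: `γ` carries `H` into `B̄(H, H)`. This is induction over the least prefixed
point, with the lifting of the law handling `ι_⋆ Σ(-)` and condition 3 handling `- ; S`. Since `H`
is reflexive, `B̄(H, H) ≤ B̄(id, H)`, so `H` is a simulation and `H ≤ S`. Thus `S` and `H` contain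
each other, and `S` inherits the congruence property. -/

theorem GraphOn.le_iff_maps {X : C} (R S : GraphOn X) : R ≤ S ↔ R.Maps (𝟙 X) S := by
  constructor <;> rintro ⟨h, hl, hr⟩
  · exact ⟨h, hl.trans (Category.comp_id _).symm, hr.trans (Category.comp_id _).symm⟩
  · exact ⟨h, hl.trans (Category.comp_id _), hr.trans (Category.comp_id _)⟩

theorem GraphOn.maps_comp {X Y Z : C} {R : GraphOn X} {S : GraphOn Y} {U : GraphOn Z}
    {f : X ⟶ Y} {g : Y ⟶ Z} (hf : R.Maps f S) (hg : S.Maps g U) : R.Maps (f ≫ g) U := by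
  obtain ⟨h, hl, hr⟩ := hf
  obtain ⟨k, kl, kr⟩ := hg
  refine ⟨h ≫ k, ?_, ?_⟩
  · rw [Category.assoc, kl, ← Category.assoc, hl, Category.assoc]
  · rw [Category.assoc, kr, ← Category.assoc, hr, Category.assoc]

theorem GraphOn.le_refl {X : C} (R : GraphOn X) : R ≤ R :=
  ⟨𝟙 _, Category.id_comp _, Category.id_comp _⟩

theorem GraphOn.le_trans {X : C} {R S U : GraphOn X} (h : R ≤ S) (k : S ≤ U) : R ≤ U := by
  rw [le_iff_maps] at *
  simpa using maps_comp h k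

theorem GraphOn.maps_of_le_left {X Y : C} {R R' : GraphOn X} {S : GraphOn Y} {f : X ⟶ Y}
    (h : R ≤ R') (k : R'.Maps f S) : R.Maps f S := by
  simpa using maps_comp ((le_iff_maps _ _).1 h) k

theorem GraphOn.maps_of_le_right {X Y : C} {R : GraphOn X} {S S' : GraphOn Y} {f : X ⟶ Y}
    (h : R.Maps f S) (k : S ≤ S') : R.Maps f S' := by
  simpa using maps_comp h ((le_iff_maps _ _).1 k)

theorem GraphOn.maps_lift (F : C ⥤ C) {X Y : C} {R : GraphOn X} {S : GraphOn Y} {f : X ⟶ Y}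
    (h : R.Maps f S) : (R.lift F).Maps (F.map f) (S.lift F) := by
  obtain ⟨k, kl, kr⟩ := h
  exact ⟨F.map k, (F.map_comp _ _).symm.trans ((congrArg F.map kl).trans (F.map_comp _ _)),
    (F.map_comp _ _).symm.trans ((congrArg F.map kr).trans (F.map_comp _ _))⟩

theorem GraphOn.lift_mono (F : C ⥤ C) {X : C} {R S : GraphOn X} (h : R ≤ S) :
    R.lift F ≤ S.lift F := by
  have := maps_lift F ((le_iff_maps _ _).1 h)
  rwa [F.map_id, ← le_iff_maps] at this

theorem GraphOn.maps_comp_graph [HasPullbacks C] {X Y : C} {R S : GraphOn X} {R' S' : GraphOn Y}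
    {f : X ⟶ Y} (hR : R.Maps f R') (hS : S.Maps f S') : (R.comp S).Maps f (R'.comp S') := by
  obtain ⟨h, hl, hr⟩ := hR
  obtain ⟨k, kl, kr⟩ := hS
  refine ⟨pullback.map _ _ _ _ h k f hr.symm kl.symm, ?_, ?_⟩
  · refine (pullback.lift_fst_assoc _ _ _ _).trans ?_
    rw [Category.assoc, hl]
    exact (Category.assoc _ _ _).symm
  · refine (pullback.lift_snd_assoc _ _ _ _).trans ?_
    rw [Category.assoc, kr]
    exact (Category.assoc _ _ _).symm

theorem GraphOn.comp_mono [HasPullbacks C] {X : C} {R S R' S' : GraphOn X}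
    (hR : R ≤ R') (hS : S ≤ S') : R.comp S ≤ R'.comp S' := by
  rw [le_iff_maps] at *
  exact maps_comp_graph hR hS

/-- Only this half of associativity is needed: it rebrackets `(ι_⋆ Σ(H) ; S) ; S` so that
transitivity of `S` applies. -/
theorem GraphOn.comp_assoc_le [HasPullbacks C] {X : C} (R S U : GraphOn X) :
    (R.comp S).comp U ≤ R.comp (S.comp U) := by
  let p : ((R.comp S).comp U).carrier ⟶ (R.comp S).carrier := pullback.fst (R.comp S).outr U.outl
  let q : ((R.comp S).comp U).carrier ⟶ U.carrier := pullback.snd (R.comp S).outr U.outl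
  have hpq : p ≫ pullback.snd R.outr S.outl ≫ S.outr = q ≫ U.outl := pullback.condition
  let a : ((R.comp S).comp U).carrier ⟶ (S.comp U).carrier :=
    pullback.lift (p ≫ pullback.snd R.outr S.outl) q (by rw [Category.assoc, hpq])
  refine ⟨pullback.lift (p ≫ pullback.fst R.outr S.outl) a ?_, ?_, ?_⟩
  · rw [Category.assoc, pullback.condition]
    refine Eq.trans ?_ (pullback.lift_fst_assoc _ _ _ _).symm
    exact (Category.assoc _ _ _).symm
  · exact (pullback.lift_fst_assoc _ _ _ _).trans (Category.assoc _ _ _)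
  · exact (pullback.lift_snd_assoc _ _ _ _).trans (pullback.lift_snd_assoc _ _ _ _)

/-- Each edge is followed by the loop at its target. With `S` reflexive, this removes the trailing
`; S` from the Howe step and leaves a congruence. -/
theorem GraphOn.le_comp_of_id_le [HasPullbacks C] {X : C} (R S : GraphOn X)
    (h : (RelOn.id X).toGraphOn ≤ S) : R ≤ R.comp S := by
  obtain ⟨k, kl, kr⟩ := h
  refine ⟨pullback.lift (𝟙 _) (R.outr ≫ k) ?_, ?_, ?_⟩
  · rw [Category.assoc, kl, Category.id_comp, Category.comp_id]
  · exact (pullback.lift_fst_assoc _ _ _ _).trans (Category.id_comp _)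
  · refine (pullback.lift_snd_assoc _ _ _ _).trans ?_
    rw [Category.assoc, kr, Category.comp_id]

/-- Each edge is preceded by the loop at its source. Applied to a reflexive `ι_⋆ Σ(H)`, this puts
`S` below its Howe closure. -/
theorem GraphOn.le_comp_of_id_le' [HasPullbacks C] {X : C} (R S : GraphOn X)
    (h : (RelOn.id X).toGraphOn ≤ R) : S ≤ R.comp S := by
  obtain ⟨k, kl, kr⟩ := h
  refine ⟨pullback.lift (S.outl ≫ k) (𝟙 _) ?_, ?_, ?_⟩
  · rw [Category.assoc, kr, Category.id_comp, Category.comp_id]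
  · refine (pullback.lift_fst_assoc _ _ _ _).trans ?_
    rw [Category.assoc, kl, Category.comp_id]
  · exact (pullback.lift_snd_assoc _ _ _ _).trans (Category.id_comp _)

theorem RelOn.maps_prod [HasBinaryProducts C] {X Y Z : C} {G : GraphOn X} {R : RelOn Y}
    {S : RelOn Z} {f : X ⟶ Y} {g : X ⟶ Z} (hf : G.Maps f R.toGraphOn)
    (hg : G.Maps g S.toGraphOn) : G.Maps (Limits.prod.lift f g) (R.prod S).toGraphOn := by
  obtain ⟨h, hl, hr⟩ := hf
  obtain ⟨k, kl, kr⟩ := hg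
  refine ⟨Limits.prod.lift h k, ?_, ?_⟩
  · apply Limits.prod.hom_ext <;> simp [hl, kl]
  · apply Limits.prod.hom_ext <;> simp [hr, kr]

/-- The identity relation on an initial algebra is contained in the lifting of any reflexive
relation. -/
theorem id_le_lift_push {F : C ⥤ C} {I : Endofunctor.Algebra F} (hI : IsInitial I)
    {R : RelOn I.a} (hR : R.IsReflexive) :
    (RelOn.id I.a).toGraphOn ≤ (R.toGraphOn.lift F).push I.str := by
  obtain ⟨k, kl, kr⟩ := hR
  -- By Lambek's lemma every element of the initial algebra has a decomposition, to which the loops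
  -- of `R` are applied under `F`.
  have : IsIso I.str := Endofunctor.Algebra.Initial.str_isIso hI
  refine ⟨inv I.str ≫ F.map k, ?_, ?_⟩
  · change (inv I.str ≫ F.map k) ≫ F.map R.outl ≫ I.str = 𝟙 I.a
    rw [Category.assoc, ← F.map_comp_assoc, kl]
    simp
  · change (inv I.str ≫ F.map k) ≫ F.map R.outr ≫ I.str = 𝟙 I.a
    rw [Category.assoc, ← F.map_comp_assoc, kr]
    simp

/-- The order reverses in the first argument. This is how a reflexive `H` yields `B̄(H, H) ≤ B̄(id,
H)`. -/
theorem BifunctorLifting.rel_mono {B : Cᵒᵖ × C ⥤ C} (L : BifunctorLifting B) {X Y : C}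
    {R R' : RelOn X} {S S' : RelOn Y} (hR : R' ≤ R) (hS : S ≤ S') :
    (L.rel R S).toGraphOn ≤ (L.rel R' S').toGraphOn := by
  have := L.maps_rel (𝟙 X) (𝟙 Y) ((GraphOn.le_iff_maps _ _).1 hR) ((GraphOn.le_iff_maps _ _).1 hS)
  rw [GraphOn.le_iff_maps]
  have h : B.map (Prod.mkHom (𝟙 X).op (𝟙 Y)) = 𝟙 (B.obj (op X, Y)) := B.map_id _
  rwa [h] at this

/-- The restriction of a relation `H` to the inverse image of a relation along `f`. -/
theorem RelOn.exists_restrict [HasPullbacks C] [HasBinaryProducts C] {X Y : C} (H : RelOn X)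
    (f : X ⟶ Y) (S : RelOn Y) : ∃ P : RelOn X, ∀ G : GraphOn X,
      G ≤ P.toGraphOn ↔ G ≤ H.toGraphOn ∧ G.Maps f S.toGraphOn := by
  -- The inverse image of `S` under `f` and its intersection with `H` are taken in one pullback. `s`
  -- is monic, so `P` is a subrelation of `H`.
  let s : S.carrier ⟶ Y ⨯ Y := prod.lift S.outl S.outr
  let t : H.carrier ⟶ Y ⨯ Y := prod.lift (H.outl ≫ f) (H.outr ≫ f)
  have hcl : pullback.fst s t ≫ S.outl = pullback.snd s t ≫ H.outl ≫ f := by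
    simpa [s, t, prod.lift_fst] using congrArg (· ≫ prod.fst) (pullback.condition (f := s) (g := t))
  have hcr : pullback.fst s t ≫ S.outr = pullback.snd s t ≫ H.outr ≫ f := by
    simpa [s, t, prod.lift_snd] using congrArg (· ≫ prod.snd) (pullback.condition (f := s) (g := t))
  refine ⟨{ carrier := pullback s t, outl := pullback.snd s t ≫ H.outl,
            outr := pullback.snd s t ≫ H.outr, jointlyMono := ?_ }, fun G => ⟨?_, ?_⟩⟩
  · intro W a b hl hr
    have h₂ : a ≫ pullback.snd s t = b ≫ pullback.snd s t :=
      H.jointlyMono _ _ (by simpa using hl) (by simpa using hr)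
    refine pullback.hom_ext (S.jointlyMono _ _ ?_ ?_) h₂
    · rw [Category.assoc, Category.assoc, hcl, ← Category.assoc, h₂, Category.assoc]
    · rw [Category.assoc, Category.assoc, hcr, ← Category.assoc, h₂, Category.assoc]
  · rintro ⟨h, hl, hr⟩
    refine ⟨⟨h ≫ pullback.snd s t, by simpa using hl, by simpa using hr⟩,
      ⟨h ≫ pullback.fst s t, ?_, ?_⟩⟩
    · refine (Category.assoc _ _ _).trans ((congrArg (h ≫ ·) hcl).trans ?_)
      rw [← hl]
      simp
    · refine (Category.assoc _ _ _).trans ((congrArg (h ≫ ·) hcr).trans ?_)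
      rw [← hr]
      simp
  · rintro ⟨⟨h, hl, hr⟩, ⟨k, kl, kr⟩⟩
    refine ⟨pullback.lift k h (Limits.prod.hom_ext ?_ ?_), ?_, ?_⟩
    · simp [s, t, prod.lift_fst, kl, ← hl]
    · simp [s, t, prod.lift_snd, kr, ← hr]
    · exact (pullback.lift_snd_assoc _ _ _ _).trans hl
    · exact (pullback.lift_snd_assoc _ _ _ _).trans hr

end GraphLemmas

/-! ### Relations as subobjects, and extremal fixed points -/

section Lattice

variable {C : Type u} [Category.{v} C] [HasBinaryProducts C]

instance RelOn.mono_lift {X : C} (R : RelOn X) :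
    Mono (prod.lift R.toGraphOn.outl R.toGraphOn.outr) :=
  ⟨fun a b hab => R.jointlyMono a b
    (by simpa [prod.lift_fst] using congrArg (· ≫ prod.fst) hab)
    (by simpa [prod.lift_snd] using congrArg (· ≫ prod.snd) hab)⟩

/-- A relation on `X` as a subobject of `X ⨯ X`. -/
noncomputable def RelOn.toSubobject {X : C} (R : RelOn X) : Subobject (X ⨯ X) :=
  Subobject.mk (prod.lift R.outl R.outr)

/-- A subobject of `X ⨯ X` as a relation on `X`. -/
noncomputable def RelOn.ofSubobject {X : C} (P : Subobject (X ⨯ X)) : RelOn X where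
  carrier := (P : C)
  outl := P.arrow ≫ prod.fst
  outr := P.arrow ≫ prod.snd
  jointlyMono a b h h' := by
    rw [← cancel_mono P.arrow]
    apply Limits.prod.hom_ext
    · simpa using h
    · simpa using h'

theorem RelOn.toSubobject_le_iff {X : C} (R S : RelOn X) :
    R.toSubobject ≤ S.toSubobject ↔ R ≤ S := by
  constructor
  · intro h
    have hc := Subobject.ofMkLEMk_comp h
    exact ⟨Subobject.ofMkLEMk _ _ h,
      by simpa [prod.lift_fst] using congrArg (· ≫ prod.fst) hc,
      by simpa [prod.lift_snd] using congrArg (· ≫ prod.snd) hc⟩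
  · rintro ⟨h, hl, hr⟩
    exact Subobject.mk_le_mk_of_comm h
      (Limits.prod.hom_ext (by simp [prod.lift_fst, hl]) (by simp [prod.lift_snd, hr]))

/-- Only this round trip is an equality: a relation is recovered from its subobject merely up to
isomorphism of carriers. -/
theorem RelOn.toSubobject_ofSubobject {X : C} (P : Subobject (X ⨯ X)) :
    (RelOn.ofSubobject P).toSubobject = P := by
  have h : prod.lift (RelOn.ofSubobject P).outl (RelOn.ofSubobject P).outr = P.arrow :=
    Limits.prod.hom_ext (prod.lift_fst _ _) (prod.lift_snd _ _)
  exact (Subobject.mk_eq_mk_of_comm (prod.lift (RelOn.ofSubobject P).outl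
    (RelOn.ofSubobject P).outr) P.arrow (Iso.refl (P : C)) ((Category.id_comp _).trans h.symm)).trans
    (Subobject.mk_arrow P)

/-- `Subobject (X ⨯ X)` has all infima. As relations are only preordered, `hp` is required of every
greatest lower bound, so the choice of representative is immaterial. -/
theorem RelOn.exists_isLeast [HasLimits C] [WellPowered.{v} C] {X : C} (p : RelOn X → Prop)
    (hp : ∀ H : RelOn X, (∀ R, p R → H ≤ R) →
      (∀ U : RelOn X, (∀ R, p R → U ≤ R) → U ≤ H) → p H) :
    ∃ H : RelOn X, p H ∧ ∀ R, p R → H ≤ R := by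
  let A : Set (Subobject (X ⨯ X)) := RelOn.toSubobject '' {R | p R}
  obtain ⟨m, hm⟩ : ∃ m, IsGLB A m :=
    ⟨Subobject.sInf.{v} A, Subobject.sInf_le.{v} A, Subobject.le_sInf.{v} A⟩
  have hle : ∀ R, p R → RelOn.ofSubobject m ≤ R := fun R hR => by
    rw [← RelOn.toSubobject_le_iff, RelOn.toSubobject_ofSubobject]
    exact hm.1 ⟨R, hR, rfl⟩
  refine ⟨RelOn.ofSubobject m, hp _ hle fun U hU => ?_, hle⟩
  rw [← RelOn.toSubobject_le_iff, RelOn.toSubobject_ofSubobject]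
  refine hm.2 ?_
  rintro _ ⟨R, hR, rfl⟩
  exact (RelOn.toSubobject_le_iff _ _).2 (hU R hR)

/-- Dual to the previous result; suprema of subobjects are images of maps out of coproducts. -/
theorem RelOn.exists_isGreatest [HasLimits C] [HasColimits C] [WellPowered.{v} C] {X : C}
    (p : RelOn X → Prop)
    (hp : ∀ H : RelOn X, (∀ R, p R → R ≤ H) →
      (∀ U : RelOn X, (∀ R, p R → R ≤ U) → H ≤ U) → p H) :
    ∃ H : RelOn X, p H ∧ ∀ R, p R → R ≤ H := by
  let A : Set (Subobject (X ⨯ X)) := RelOn.toSubobject '' {R | p R}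
  obtain ⟨m, hm⟩ : ∃ m, IsLUB A m :=
    ⟨Subobject.sSup.{v} A, Subobject.le_sSup.{v} A, Subobject.sSup_le.{v} A⟩
  have hle : ∀ R, p R → R ≤ RelOn.ofSubobject m := fun R hR => by
    rw [← RelOn.toSubobject_le_iff, RelOn.toSubobject_ofSubobject]
    exact hm.1 ⟨R, hR, rfl⟩
  refine ⟨RelOn.ofSubobject m, hp _ hle fun U hU => ?_, hle⟩
  rw [← RelOn.toSubobject_le_iff, RelOn.toSubobject_ofSubobject]
  refine hm.2 ?_
  rintro _ ⟨R, hR, rfl⟩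
  exact (RelOn.toSubobject_le_iff _ _).2 (hU R hR)

end Lattice

/-! ### The relation generated by a graph, and congruences. -/

section DaggerLemmas

variable {C : Type u} [Category.{v} C] [HasLimits C] [WellPowered.{v} C]

theorem GraphOn.le_dagger {X : C} (R : GraphOn X) : R ≤ R.dagger.toGraphOn :=
  ⟨R.toDagger, R.toDagger_outl, R.toDagger_outr⟩

/-- `F(R)` and composites are in general not jointly monic. Below a relation the difference
vanishes, so most arguments can stay with graphs. -/
theorem GraphOn.dagger_le_iff {X : C} (R : GraphOn X) (S : RelOn X) :
    R.dagger.toGraphOn ≤ S.toGraphOn ↔ R ≤ S.toGraphOn := by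
  rw [le_iff_maps, le_iff_maps, dagger_maps_iff]

theorem RelOn.maps_lift (F : C ⥤ C) {X Y : C} {R : RelOn X} {S : RelOn Y} {f : X ⟶ Y}
    (h : R.toGraphOn.Maps f S.toGraphOn) :
    (R.lift F).toGraphOn.Maps (F.map f) (S.lift F).toGraphOn :=
  (GraphOn.dagger_maps_iff _ _ _).2
    (GraphOn.maps_of_le_right (GraphOn.maps_lift F h) (GraphOn.le_dagger _))

/-- Composition with a relation on the right commutes with the generated relation, as strong
epimorphisms are stable under pullback. -/
theorem GraphOn.dagger_comp_le (hStable : StrongEpiPullbackStable C) {X : C} (G : GraphOn X)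
    (S : GraphOn X) (U : RelOn X) (h : G.comp S ≤ U.toGraphOn) :
    G.dagger.toGraphOn.comp S ≤ U.toGraphOn := by
  let e : pullback G.outr S.outl ⟶ pullback G.dagger.outr S.outl :=
    pullback.lift (pullback.fst _ _ ≫ G.toDagger) (pullback.snd _ _)
      (by rw [Category.assoc, G.toDagger_outr, pullback.condition])
  have hfst : e ≫ pullback.fst _ _ = pullback.fst _ _ ≫ G.toDagger := pullback.lift_fst _ _ _
  have hsnd : e ≫ pullback.snd _ _ = pullback.snd _ _ := pullback.lift_snd _ _ _
  -- Pullback pasting: the outer rectangle defines `G.comp S` and one inner square defines `G.dagger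
  -- ; S`, so the remaining square exhibits `e` as a pullback of the strong epimorphism
  -- `G.toDagger`.
  have hbig : IsPullback (e ≫ pullback.snd G.dagger.outr S.outl) (pullback.fst G.outr S.outl)
      S.outl (G.toDagger ≫ G.dagger.outr) := by
    rw [hsnd, G.toDagger_outr]
    exact (IsPullback.of_hasPullback G.outr S.outl).flip
  have hpb : IsPullback (pullback.fst G.outr S.outl) e G.toDagger
      (pullback.fst G.dagger.outr S.outl) := by
    exact (IsPullback.of_right hbig hfst
      (IsPullback.of_hasPullback G.dagger.outr S.outl).flip).flip
  have he : StrongEpi e := hStable _ _ _ _ hpb inferInstance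
  obtain ⟨k, kl, kr⟩ := h
  refine exists_diagonal e U k _ _ ?_ ?_
  · rw [kl, GraphOn.comp_outl, GraphOn.comp_outl, ← Category.assoc, hfst, Category.assoc,
      G.toDagger_outl]
  · rw [kr, GraphOn.comp_outr, GraphOn.comp_outr, ← Category.assoc, hsnd]

/-- The codiagonal on edges lies over the codiagonal on vertices; this covers the factor `Σ^⋆∇` in
the operational model. -/
theorem RelOn.coprod_maps_desc [HasBinaryCoproducts C] {X : C} (R : RelOn X) :
    (R.coprod R).toGraphOn.Maps (coprod.desc (𝟙 X) (𝟙 X)) R.toGraphOn := by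
  refine (GraphOn.dagger_maps_iff _ _ _).2 ⟨coprod.desc (𝟙 _) (𝟙 _), ?_, ?_⟩
  · apply Limits.coprod.hom_ext <;> simp
  · apply Limits.coprod.hom_ext <;> simp

/-- The structure map of a congruence lifts to its relation over the free monad. -/
theorem emStr_maps {F : C ⥤ C} [(Endofunctor.Algebra.forget F).IsRightAdjoint]
    (hF : PreservesStrongEpi F) (A : Endofunctor.Algebra F) (S : RelOn A.a)
    (hS : IsCongruence A S) :
    (S.lift (freeFunctor F)).toGraphOn.Maps (emStr A) S.toGraphOn := by
  obtain ⟨k, ⟨hk, hη, hm⟩, -⟩ := (lift_freeFunctor_isFree F hF S).2.2 A S hS (𝟙 A.a)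
    ((GraphOn.le_iff_maps _ _).1 (GraphOn.le_refl _))
  let κ : (Endofunctor.Algebra.forget F).leftAdjoint.obj A.a ⟶ A := ⟨k, hk⟩
  -- Both algebra morphisms restrict to the identity along the unit, the counit by a triangle
  -- identity.
  have h : κ = (freeAdj F).counit.app A := by
    apply ((freeAdj F).homEquiv A.a A).injective
    refine ((freeAdj F).homEquiv_unit A.a A κ).trans ?_
    refine Eq.trans hη ?_
    refine Eq.trans ?_ ((freeAdj F).homEquiv_unit A.a A _).symm
    exact ((freeAdj F).right_triangle_components A).symm
  have : k = emStr A := congrArg Endofunctor.Algebra.Hom.f h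
  rwa [← this]

/-- A congruence on an initial algebra is reflexive. -/
theorem IsCongruence.isReflexive {F : C ⥤ C} {I : Endofunctor.Algebra F} (hI : IsInitial I)
    {R : RelOn I.a} (hR : IsCongruence I R) : R.IsReflexive := by
  obtain ⟨s, hl, hr⟩ := (GraphOn.dagger_maps_iff _ _ _).1 hR
  -- A congruence makes the edges an algebra with both legs homomorphisms; by initiality, the unique
  -- map into it is a common section of the legs.
  let A : Endofunctor.Algebra F := ⟨R.carrier, s⟩
  let l : A ⟶ I := ⟨R.outl, hl.symm⟩
  let r : A ⟶ I := ⟨R.outr, hr.symm⟩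
  exact ⟨(hI.to A).f, congrArg Endofunctor.Algebra.Hom.f (hI.hom_ext (hI.to A ≫ l) (𝟙 I)),
    congrArg Endofunctor.Algebra.Hom.f (hI.hom_ext (hI.to A ≫ r) (𝟙 I))⟩

end DaggerLemmas

/-! ### Howe's closure -/

section HoweClosure

variable {C : Type u} [Category.{v} C]

/-- `R ↦ ι_⋆ F(R) ; S`, whose least prefixed point is Howe's closure of `S`. -/
noncomputable def howeStep [HasPullbacks C] {F : C ⥤ C} (A : Endofunctor.Algebra F) (S R : RelOn A.a) :
    GraphOn A.a :=
  ((R.toGraphOn.lift F).push A.str).comp S.toGraphOn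

theorem howeStep_mono [HasPullbacks C] {F : C ⥤ C} (A : Endofunctor.Algebra F) (S : RelOn A.a) {R R' : RelOn A.a}
    (h : R ≤ R') : howeStep A S R ≤ howeStep A S R' := by
  refine GraphOn.comp_mono ?_ (GraphOn.le_refl _)
  exact GraphOn.maps_of_le_left (GraphOn.lift_mono F h)
    ⟨𝟙 _, Category.id_comp _, Category.id_comp _⟩

variable [HasLimits C] [WellPowered.{v} C]

/-- Knaster–Tarski: by monotonicity, the step applied to the meet of all prefixed points lies below
each of them, hence below the meet. The step is only a graph, so its generated relation is compared.
-/
theorem exists_howe {F : C ⥤ C} (A : Endofunctor.Algebra F) (S : RelOn A.a) :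
    ∃ H : RelOn A.a, howeStep A S H ≤ H.toGraphOn ∧
      ∀ R : RelOn A.a, howeStep A S R ≤ R.toGraphOn → H ≤ R := by
  refine RelOn.exists_isLeast (fun R => howeStep A S R ≤ R.toGraphOn) fun H hH hU => ?_
  rw [← GraphOn.dagger_le_iff]
  refine hU _ fun R hR => (GraphOn.dagger_le_iff _ _).2 ?_
  exact GraphOn.le_trans (howeStep_mono A S (hH R hR)) hR

/-- A least prefixed point of `howeStep` is absorbing for a transitive relation `S`. -/
theorem howe_comp_le (hStable : StrongEpiPullbackStable C) {F : C ⥤ C} (A : Endofunctor.Algebra F)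
    (S H : RelOn A.a) (hS : S.toGraphOn.comp S.toGraphOn ≤ S.toGraphOn)
    (hH : howeStep A S H ≤ H.toGraphOn)
    (hleast : ∀ R : RelOn A.a, howeStep A S R ≤ R.toGraphOn → H ≤ R) :
    H.toGraphOn.comp S.toGraphOn ≤ H.toGraphOn := by
  -- The relation generated by the step at `H` is itself prefixed, so by leastness `H` is also a
  -- postfixed point.
  have hle : H ≤ (howeStep A S H).dagger := hleast _ <| GraphOn.le_trans
    (howeStep_mono A S ((GraphOn.dagger_le_iff _ _).2 hH)) (GraphOn.le_dagger _)
  refine GraphOn.le_trans (GraphOn.comp_mono hle (GraphOn.le_refl _)) ?_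
  refine GraphOn.dagger_comp_le hStable _ _ _ ?_
  refine GraphOn.le_trans (GraphOn.comp_assoc_le _ _ _) ?_
  exact GraphOn.le_trans (GraphOn.comp_mono (GraphOn.le_refl _) hS) hH

end HoweClosure

/-! ### Simulations -/

section Simulations

variable {C : Type u} [Category.{v} C] [HasLimits C] [WellPowered.{v} C]

/-- Let `H` be the join of all such relations and `P` the part of `H` that `γ` sends into `B̄(id,
H)`. Each candidate lies in `P` by monotonicity of `B̄(id, -)`, hence so does `H`. -/
theorem exists_greatest_maps [HasColimits C] {B : Cᵒᵖ × C ⥤ C} (L : BifunctorLifting B) {X : C}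
    (γ : X ⟶ B.obj (op X, X)) :
    ∃ R : RelOn X, R.toGraphOn.Maps γ (L.rel (RelOn.id X) R).toGraphOn ∧
      ∀ S : RelOn X, S.toGraphOn.Maps γ (L.rel (RelOn.id X) S).toGraphOn → S ≤ R := by
  refine RelOn.exists_isGreatest
    (fun R : RelOn X => R.toGraphOn.Maps γ (L.rel (RelOn.id X) R).toGraphOn) fun H hH hU => ?_
  obtain ⟨P, hP⟩ := H.exists_restrict γ (L.rel (RelOn.id X) H)
  refine ((hP _).1 (hU P fun R hR => (hP _).2 ⟨hH R hR, ?_⟩)).2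
  exact GraphOn.maps_of_le_right hR (L.rel_mono (GraphOn.le_refl _) (hH R hR))

/-- Composites of relations over a `B(X, -)`-coalgebra structure. -/
theorem BifunctorLifting.comp_maps {B : Cᵒᵖ × C ⥤ C} {L : BifunctorLifting B}
    {P : ∀ D : Cᵒᵖ × C, PreorderOn (B.obj D)} (hL : L.GoodForSimulations P) {X Y : C}
    {γ : Y ⟶ B.obj (op X, Y)} {G : GraphOn Y} {R : RelOn X} {S S' : RelOn Y}
    (hG : G.Maps γ (L.rel R S).toGraphOn)
    (hS' : S'.toGraphOn.Maps γ (L.rel (RelOn.id X) S').toGraphOn) :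
    (G.comp S'.toGraphOn).Maps γ (L.rel R (S.comp S')).toGraphOn :=
  GraphOn.maps_of_le_right (GraphOn.maps_of_le_right (GraphOn.maps_comp_graph hG hS')
    (GraphOn.le_dagger _)) (hL.comp R S S')

end Simulations

/-! ### Howe's method for the operational model. -/

section Howe

variable {C : Type u} [Category.{v} C] [HasLimits C] [HasColimits C] [WellPowered.{v} C]
  {V : C} {T : C ⥤ C} {B : Cᵒᵖ × C ⥤ C}
  [(Endofunctor.Algebra.forget (syntaxFunctor V T)).IsRightAdjoint]

/-- The law, on an algebra with a reflexive congruence `H`, respects relations. -/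
theorem HOGSOSLaw.algApp_maps (hT : PreservesStrongEpi (syntaxFunctor V T))
    {L : BifunctorLifting B} {ρ : HOGSOSLaw V T B} (hρ : ρ.HasRelLifting L)
    (A : Endofunctor.Algebra (syntaxFunctor V T)) (H : RelOn A.a) (hH : H.IsReflexive)
    (hc : IsCongruence A H) :
    ((H.prod (L.rel H H)).lift (syntaxFunctor V T)).toGraphOn.Maps (ρ.algApp A)
      (L.rel H H).toGraphOn := by
  have hid : H.toGraphOn.Maps (𝟙 A.a) H.toGraphOn := (GraphOn.le_iff_maps _ _).1 (GraphOn.le_refl _)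
  -- Reflexivity of `H` supplies the loops at the points named by `V`, as the lifted law demands.
  have hpt : (RelOn.id V).toGraphOn.Maps (pointed A).hom H.toGraphOn := by
    obtain ⟨k, kl, kr⟩ := hH
    refine ⟨(pointed A).hom ≫ k, ?_, ?_⟩
    · refine (Category.assoc _ _ _).trans ((congrArg ((pointed A).hom ≫ ·) kl).trans ?_)
      exact (Category.comp_id _).trans (Category.id_comp _).symm
    · refine (Category.assoc _ _ _).trans ((congrArg ((pointed A).hom ≫ ·) kr).trans ?_)
      exact (Category.comp_id _).trans (Category.id_comp _).symm
  exact GraphOn.maps_comp (hρ (pointed A) H hpt A.a H) <| GraphOn.maps_comp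
    (L.maps_rel (𝟙 A.a) _ hid (RelOn.maps_lift (freeFunctor (syntaxFunctor V T))
      H.coprod_maps_desc))
    (L.maps_rel (𝟙 A.a) _ hid (emStr_maps hT A H hc))

/-- Howe's closure of a reflexive, transitive simulation is a simulation, even with
respect to itself in the contravariant argument. -/
theorem howe_maps (hT : PreservesStrongEpi (syntaxFunctor V T))
    {L : BifunctorLifting B} {P : ∀ D : Cᵒᵖ × C, PreorderOn (B.obj D)}
    (hL : L.GoodForSimulations P) {ρ : HOGSOSLaw V T B} (hρ : ρ.HasRelLifting L)
    {I : Endofunctor.Algebra (syntaxFunctor V T)} (γ : I.a ⟶ B.obj (op I.a, I.a))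
    (hγ : I.str ≫ γ = (syntaxFunctor V T).map (prod.lift (𝟙 I.a) γ) ≫ ρ.algApp I)
    {S H : RelOn I.a} (hS : S.toGraphOn.Maps γ (L.rel (RelOn.id I.a) S).toGraphOn)
    (hH : howeStep I S H ≤ H.toGraphOn)
    (hleast : ∀ R : RelOn I.a, howeStep I S R ≤ R.toGraphOn → H ≤ R)
    (hrefl : H.IsReflexive) (hc : IsCongruence I H)
    (habs : H.toGraphOn.comp S.toGraphOn ≤ H.toGraphOn) :
    H.toGraphOn.Maps γ (L.rel H H).toGraphOn := by
  -- Induction predicate: the part `Q` of `H` that `γ` sends into `B̄(H, H)`. The target is fixed at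
  -- `H`, so the mixed variance of `B̄` causes no trouble; it remains to see that `Q` is prefixed.
  obtain ⟨Q, hQ⟩ := H.exists_restrict γ (L.rel H H)
  obtain ⟨hQH, hQγ⟩ := (hQ _).1 (GraphOn.le_refl Q.toGraphOn)
  refine ((hQ _).1 (hleast Q ((hQ _).2
    ⟨GraphOn.le_trans (howeStep_mono I S hQH) hH, ?_⟩))).2
  have h₁ : Q.toGraphOn.Maps (prod.lift (𝟙 I.a) γ) (H.prod (L.rel H H)).toGraphOn :=
    RelOn.maps_prod ((GraphOn.le_iff_maps _ _).1 hQH) hQγ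
  have h₂ : (Q.toGraphOn.lift (syntaxFunctor V T)).Maps (I.str ≫ γ) (L.rel H H).toGraphOn := by
    rw [hγ]
    exact GraphOn.maps_comp (GraphOn.maps_of_le_right
      (GraphOn.maps_lift (syntaxFunctor V T) h₁) (GraphOn.le_dagger _))
      (ρ.algApp_maps hT hρ I H hrefl hc)
  have h₃ : ((Q.toGraphOn.lift (syntaxFunctor V T)).push I.str).Maps γ (L.rel H H).toGraphOn := by
    obtain ⟨k, kl, kr⟩ := h₂
    exact ⟨k, kl.trans (Category.assoc _ _ _).symm, kr.trans (Category.assoc _ _ _).symm⟩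
  -- `B̄(H, H) • B̄(id, S) ≤ B̄(H, H • S) ≤ B̄(H, H)`, by condition 3 and then absorption.
  exact GraphOn.maps_of_le_right (BifunctorLifting.comp_maps hL h₃ hS)
    (L.rel_mono (GraphOn.le_refl _) ((GraphOn.dagger_le_iff _ _).2 habs))

/-- The greatest relation compatible with the operational model is a congruence. -/
theorem isCongruence_of_greatest (hStable : StrongEpiPullbackStable C)
    (hT : PreservesStrongEpi (syntaxFunctor V T))
    {L : BifunctorLifting B} {P : ∀ D : Cᵒᵖ × C, PreorderOn (B.obj D)}
    (hL : L.GoodForSimulations P) {ρ : HOGSOSLaw V T B} (hρ : ρ.HasRelLifting L)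
    {I : Endofunctor.Algebra (syntaxFunctor V T)} (hI : IsInitial I)
    (γ : I.a ⟶ B.obj (op I.a, I.a))
    (hγ : I.str ≫ γ = (syntaxFunctor V T).map (prod.lift (𝟙 I.a) γ) ≫ ρ.algApp I)
    (S : RelOn I.a) (hS : S.toGraphOn.Maps γ (L.rel (RelOn.id I.a) S).toGraphOn)
    (hmax : ∀ R : RelOn I.a, R.toGraphOn.Maps γ (L.rel (RelOn.id I.a) R).toGraphOn → R ≤ S) :
    IsCongruence I S := by
  have hSrefl : S.IsReflexive := by
    -- The identity relation is a simulation because `B̄(id, id)` is reflexive.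
    refine hmax _ ?_
    obtain ⟨k, kl, kr⟩ := hL.refl I.a I.a
    refine ⟨γ ≫ k, ?_, ?_⟩
    · rw [Category.assoc, kl, Category.comp_id, Category.id_comp]
    · rw [Category.assoc, kr, Category.comp_id, Category.id_comp]
  have hStrans : S.toGraphOn.comp S.toGraphOn ≤ S.toGraphOn :=
    GraphOn.le_trans (GraphOn.le_dagger _) (hmax (S.comp S)
      ((GraphOn.dagger_maps_iff _ _ _).2 (BifunctorLifting.comp_maps hL hS hS)))
  obtain ⟨H, hH, hleast⟩ := exists_howe I S
  have hc : (H.toGraphOn.lift (syntaxFunctor V T)).push I.str ≤ H.toGraphOn :=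
    GraphOn.le_trans (GraphOn.le_comp_of_id_le _ _ hSrefl) hH
  have hcong : IsCongruence I H := (GraphOn.dagger_maps_iff _ _ _).2 hc
  have hrefl := hcong.isReflexive hI
  have hSH : S ≤ H := GraphOn.le_trans
    (GraphOn.le_comp_of_id_le' _ _ (id_le_lift_push hI hrefl)) hH
  have hHγ := howe_maps hT hL hρ γ hγ hS hH hleast hrefl hcong
    (howe_comp_le hStable I S H hStrans hH hleast)
  have hHS : H ≤ S := hmax H
    (GraphOn.maps_of_le_right hHγ (L.rel_mono hrefl (GraphOn.le_refl _)))
  -- `ι_⋆ Σ(S) ≤ ι_⋆ Σ(H) ≤ H ≤ S`.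
  exact (GraphOn.dagger_maps_iff _ _ _).2 (GraphOn.maps_of_le_right (GraphOn.maps_of_le_left
    (GraphOn.lift_mono (syntaxFunctor V T) hSH) hc) hHS)

end Howe

end HOGSOS

theorem mainTheorem6 {C : Type u} [Category.{v} C] [HasLimits C] [HasColimits C]
    [WellPowered.{v} C] (hStable : HOGSOS.StrongEpiPullbackStable C)
    (hDist : HOGSOS.LocallyDistributive C)
    (V : C) (T : C ⥤ C)
    [(Endofunctor.Algebra.forget (HOGSOS.syntaxFunctor V T)).IsRightAdjoint]
    (hT : HOGSOS.PreservesStrongEpi (HOGSOS.syntaxFunctor V T))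
    (B : Cᵒᵖ × C ⥤ C) (L : HOGSOS.BifunctorLifting B)
    (hL : L.GoodForSimulations (fun D => HOGSOS.PreorderOn.discrete (B.obj D)))
    (ρ : HOGSOS.HOGSOSLaw V T B) (hρ : ρ.HasRelLifting L)
    (I : Endofunctor.Algebra (HOGSOS.syntaxFunctor V T)) (hI : IsInitial I) :
    (∃ R : HOGSOS.RelOn I.a,
      HOGSOS.IsSimilarity (L.fixLeft (HOGSOS.RelOn.id I.a)) (ρ.operationalModel hI) R) ∧
    ∀ R : HOGSOS.RelOn I.a,
      HOGSOS.IsSimilarity (L.fixLeft (HOGSOS.RelOn.id I.a)) (ρ.operationalModel hI) R →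
        HOGSOS.IsCongruence I R := by
  refine ⟨?_, fun R hR => ?_⟩
  · exact HOGSOS.exists_greatest_maps L (ρ.operationalModel hI).str
  -- A simulation for `L.fixLeft` unfolds definitionally to a relation that `γ` carries into `B̄(id,
  -- R)`; the recursion equation is the characterization of `γ` applied to itself.
  · exact HOGSOS.isCongruence_of_greatest hStable hT hL hρ hI (ρ.operationalModel hI).str
      ((ρ.eq_operationalModel_iff hI _).1 rfl) R hR.1 hR.2
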